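/- Consider a first-price auction for one item with bidders $N=\{1,\dots,n\}$ and a finite bidding space $B\subseteq[0,1]$ with $0\in B$. At a bid profile $\mathbf b=(b_1,\dots,b_n)\in B^n$ let $W(\mathbf b)$ be the set of bidders submitting a highest bid; the ex-post utility of bidder $i$ with value $v_i\in[0,1]$ is $\tilde u_i(\mathbf b;v_i)=\frac{1}{|W(\mathbf b)|}(v_i-b_i)$ if $i\in W(\mathbf b)$, and $0$ otherwise (uniform tie-breaking). For each pair of bidders $i\neq j$, bidder $i$ has a subjective prior over the value of bidder $j$: a Borel probability measure $F_{i,j}$ on $[0,1]$ whose cumulative distribution function $x\mapsto F_{i,j}([0,x])$ is continuous on $[0,1]$. A (pure) strategy of bidder $i$ is a measurable function $\beta_i:[0,1]\to B$. Against the strategies $\boldsymbol\beta_{-i}=(\beta_j)_{j\ne i}$, bidder $i$ with value $v_i$ who bids $b\in B$ has the expected utility $$u_i(b,\boldsymbol\beta_{-i};v_i)=\mathbb E_{v_{-i}\sim\prod_{j\neq i}F_{i,j}}\big[\tilde u_i\big(b,(\beta_j(v_j))_{j\neq i};v_i\big)\big].$$ A strategy profile $(\beta_1,\dots,\beta_n)$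 is a pure Bayes-Nash equilibrium if $u_i(\beta_i(v_i),\boldsymbol\beta_{-i};v_i)\ge u_i(b,\boldsymbol\beta_{-i};v_i)$ for every bidder $i$, every value $v_i\in[0,1]$ and every $b\in B$. Then every such auction has a pure Bayes-Nash equilibrium $(\beta_1,\dots,\beta_n)$ in which every $\beta_i$ is monotone non-decreasing and non-overbidding, i.e. $\beta_i(v)\le v$ for all $v\in[0,1]$. -/

import Mathlib

open MeasureTheory unitInterval

/-- A first-price auction of one item with bidders `Fin n`, values in `[0,1]`, a finite bidding
space containing the null bid, and, for every bidder `i` and every other bidder `j`, the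
(subjective) prior of `i` over the value of `j`, a Borel probability measure on `[0,1]` with
continuous cumulative distribution function. -/
structure FirstPriceAuction (n : ℕ) where
  bids : Finset ℝ
  bids_subset : ∀ b ∈ bids, b ∈ Set.Icc (0 : ℝ) 1
  zero_mem : (0 : ℝ) ∈ bids
  prior : (i : Fin n) → {j : Fin n // j ≠ i} → ProbabilityMeasure I
  continuous_prior : ∀ (i : Fin n) (j : {j : Fin n // j ≠ i}),
    Continuous fun x : I => (prior i j : Measure I).real (Set.Iic x)

namespace FirstPriceAuction

/-- The set of bidders who submit a highest bid in the bid profile `b`. -/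
noncomputable def winners {n : ℕ} (b : Fin n → ℝ) : Finset (Fin n) :=
  Finset.univ.filter fun i => ∀ j, b j ≤ b i

/-- The ex-post utility of bidder `i` with value `v` at the bid profile `b`, with uniform
tie-breaking. -/
noncomputable def exPostUtility {n : ℕ} (b : Fin n → ℝ) (i : Fin n) (v : ℝ) : ℝ :=
  if i ∈ winners b then 1 / ((winners b).card : ℝ) * (v - b i) else 0

variable {n : ℕ} (A : FirstPriceAuction n)

/-- A (pure) strategy maps values to bids. -/
abbrev Strategy : Type := I → A.bids

/-- The bid profile in which bidder `i` bids `b` and every other bidder `j` bids according to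
her strategy `β j` at the value `w j`. -/
noncomputable def bidProfile (β : Fin n → A.Strategy) (i : Fin n) (b : A.bids)
    (w : {j : Fin n // j ≠ i} → I) : Fin n → ℝ :=
  fun j => if h : j = i then (b : ℝ) else (β j (w ⟨j, h⟩) : ℝ)

/-- The ex-interim utility of bidder `i` with value `v` who bids `b` against the strategies of
the others in `β`: the expected ex-post utility, where `i` believes the values of the others to
be drawn independently from her priors. (The component `β i` is not used.) -/
noncomputable def utility (β : Fin n → A.Strategy) (i : Fin n) (b : A.bids) (v : I) : ℝ :=
  ∫ w, exPostUtility (A.bidProfile β i b w) i v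
    ∂Measure.pi fun j : {j : Fin n // j ≠ i} => (A.prior i j : Measure I)

/-- A pure (ex-interim, exact) Bayes-Nash equilibrium: a profile of strategies (measurable, so that
the expectations are meaningful) such that no bidder, at any value, gains by another bid. -/
def IsBayesNashEquilibrium (β : Fin n → A.Strategy) : Prop :=
  (∀ i, Measurable (β i)) ∧
    ∀ (i : Fin n) (v : I) (b : A.bids), A.utility β i b v ≤ A.utility β i (β i v) v

end FirstPriceAuction

/-!
Against a profile of strategies, bidder `i` with value `x` who bids `b` has the utility
`Q b * (x - b)`, where the winning probability `Q` is non-decreasing in `b`. Differences of utilities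
between a higher and a lower bid therefore grow with `x` (single crossing), so that best responses
can be described by thresholds: a bid `b` is considered at values above a threshold `τ b ≥ b` only.
As the priors have no atoms in `(0, 1]`, and as a threshold strategy always bids `0` at the value
`0`, winning probabilities depend continuously on the thresholds (`continuous_winProb`).

Let `D b` be the gain, at the value `τ b`, from the best bid at least `b` over the best bid less
than `b` (`thresholdGain`). The map that lowers every threshold by its gain, truncated to `[0, 1]`,
is continuous, and Brouwer's theorem gives a fixed point; there `D b ≤ 0` for `b ≠ 0`, with equality if
the threshold is less than `1` (`exists_equilibrium_thresholds`). By single crossing, the bid of the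
threshold strategy is then optimal at every value (`payoff_le_payoff_thresholdStrategy`): the least
optimal bid `m` is not higher; if it is lower, some bid at least as high as that of the strategy ties
with `m` on an interval of values, which is possible only if none of the bids in between ever wins.
The thresholds of the fixed point need not be ordered: the strategy uses the highest bid whose
threshold has been passed.

Brouwer's theorem is proved analytically. For a compactly supported `C¹` map `g` and
`H t x = x + t • g x`, the integral of `(R² - ‖H t x‖²) ^ k * det (D (H t) x)` over a large ball is a
polynomial in `t`. For small `t` the map `H t` is a diffeomorphism of the ball, so the integral has
the same value as for `t = 0`; hence so it has at `t = 1` (`integral_pow_mul_det_eq`). If `H 1` had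
no zero, this would fail for large `k`, as `‖H 1 x‖` would be bounded away from `0`
(`exists_add_eq_zero_of_contDiff`). Continuous maps are approximated by `C¹` maps.
-/

/-! ### Brouwer's fixed point theorem -/

section Brouwer

open Metric Polynomial Filter Topology
open scoped NNReal InnerProductSpace

/-- A parametric integral whose integrand is, at every point, a polynomial in the parameter of
bounded degree is constant as soon as it is constant for small positive parameters. -/
theorem integral_eq_of_natDegree_le {X : Type*} [MeasurableSpace X] {μ : Measure X}
    {F : ℝ → X → ℝ} {d : ℕ} {ε c : ℝ} (hint : ∀ t, Integrable (F t) μ)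
    (hpoly : ∀ x, ∃ p : ℝ[X], p.natDegree ≤ d ∧ ∀ t, p.eval t = F t x) (hε : 0 < ε)
    (hc : ∀ t, 0 < t → t < ε → ∫ x, F t x ∂μ = c) (t : ℝ) : ∫ x, F t x ∂μ = c := by
  -- Lagrange interpolation at `d + 1` nodes in `(0, ε)`
  set v : ℕ → ℝ := fun i => ε / (i + 2) with hv
  set s : Finset ℕ := Finset.range (d + 1)
  have hvs : Set.InjOn v s := by
    intro i _ j _ hij
    have hi : ((i : ℝ) + 2) ≠ 0 := by positivity
    have hj : ((j : ℝ) + 2) ≠ 0 := by positivity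
    simp only [hv] at hij
    rw [div_eq_div_iff hi hj] at hij
    have := mul_left_cancel₀ hε.ne' hij
    exact_mod_cast (by linarith : (i : ℝ) = j)
  have hF : ∀ x, F t x = ∑ i ∈ s, F (v i) x * (Lagrange.basis s v i).eval t := by
    intro x
    obtain ⟨p, hpd, hp⟩ := hpoly x
    have hdeg : p.degree < (s.card : WithBot ℕ) := by
      refine lt_of_le_of_lt degree_le_natDegree ?_
      simp only [s, Finset.card_range]
      exact_mod_cast Nat.lt_succ_of_le hpd
    have h := congrArg (eval t) (Lagrange.eq_interpolate hvs hdeg)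
    rw [Lagrange.interpolate_apply, eval_finsetSum] at h
    simpa [hp] using h
  have hnode : ∀ i, ∫ x, F (v i) x ∂μ = c := by
    intro i
    refine hc _ (by positivity) ?_
    rw [hv, div_lt_iff₀ (by positivity)]
    nlinarith [(Nat.cast_nonneg i : (0 : ℝ) ≤ i)]
  simp_rw [hF]
  rw [integral_finsetSum _ fun i _ => (hint _).mul_const _]
  simp_rw [integral_mul_const, hnode, ← Finset.mul_sum, ← eval_finsetSum]
  rw [Lagrange.sum_basis hvs (by simp [s]), eval_one, mul_one]

/-- The determinant of `1 + t • L` is a polynomial in `t` of degree at most the dimension. -/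
theorem exists_polynomial_det_one_add_smul {E : Type*} [NormedAddCommGroup E] [NormedSpace ℝ E]
    [FiniteDimensional ℝ E] (L : E →L[ℝ] E) :
    ∃ p : ℝ[X], p.natDegree ≤ Module.finrank ℝ E ∧
      ∀ t : ℝ, p.eval t = (ContinuousLinearMap.id ℝ E + t • L).det := by
  classical
  let b := Module.finBasis ℝ E
  let M := LinearMap.toMatrix b b (L : E →ₗ[ℝ] E)
  refine ⟨_, (natDegree_det_X_add_C_le M 1).trans (by simp), fun t => ?_⟩
  rw [← coe_evalRingHom, RingHom.map_det, ContinuousLinearMap.det, ← LinearMap.det_toMatrix b]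
  congr 1
  ext i j
  simp [M, Matrix.one_apply, LinearMap.toMatrix_apply, Finsupp.single_apply, apply_ite, eq_comm,
    add_comm]
  exact mul_comm _ _

variable {E : Type*} [NormedAddCommGroup E] [InnerProductSpace ℝ E] [FiniteDimensional ℝ E]

section Degree

variable [MeasurableSpace E] [BorelSpace E]

/-- A small multiple of a compactly supported `C¹` vector field perturbs the identity to a
diffeomorphism of a ball, so that the change of variables formula holds without absolute value. -/
theorem exists_integral_comp_mul_det_eq {g : E → E} {R : ℝ} (hg : ContDiff ℝ 1 g)
    (hR : Function.support g ⊆ closedBall 0 R) :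
    ∃ ε > 0, ∀ t : ℝ, 0 < t → t < ε → ∀ φ : E → ℝ,
      ∫ x in closedBall (0 : E) R, φ (x + t • g x) *
        (ContinuousLinearMap.id ℝ E + t • fderiv ℝ g x).det =
      ∫ x in closedBall (0 : E) R, φ x := by
  have hcs : HasCompactSupport g :=
    HasCompactSupport.of_support_subset_isCompact (isCompact_closedBall 0 R) hR
  obtain ⟨K, hK⟩ := hg.lipschitzWith_of_hasCompactSupport hcs one_ne_zero
  have hdet : ∀ᶠ L : E →L[ℝ] E in 𝓝 (ContinuousLinearMap.id ℝ E), 0 < L.det := by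
    refine continuousAt_const.eventually_lt ContinuousLinearMap.continuous_det.continuousAt ?_
    simp [ContinuousLinearMap.det]
  obtain ⟨η, hη, hηdet⟩ := Metric.eventually_nhds_iff.1 hdet
  refine ⟨min (1 / (K + 1)) (η / (K + 1)), by positivity, fun t ht htε φ => ?_⟩
  have hK1 : (0 : ℝ) < K + 1 := by positivity
  have ht1 : t * (K + 1) < 1 := (lt_div_iff₀ hK1).1 (htε.trans_le (min_le_left _ _))
  have ht2 : t * (K + 1) < η := (lt_div_iff₀ hK1).1 (htε.trans_le (min_le_right _ _))
  set H : E → E := fun x => x + t • g x with hH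
  have hderiv : ∀ x, HasFDerivAt H (ContinuousLinearMap.id ℝ E + t • fderiv ℝ g x) x := fun x =>
    (hasFDerivAt_id x).add
      (((hg.differentiable one_ne_zero).differentiableAt.hasFDerivAt).const_smul t)
  have hpos : ∀ x, 0 < (ContinuousLinearMap.id ℝ E + t • fderiv ℝ g x).det := by
    intro x
    refine hηdet ?_
    rw [dist_eq_norm, add_sub_cancel_left, norm_smul, Real.norm_of_nonneg ht.le]
    have := norm_fderiv_le_of_lipschitz ℝ hK (x₀ := x)
    nlinarith
  have hbij : Function.Bijective H := by
    have hap : ApproximatesLinearOn H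
        ((ContinuousLinearEquiv.refl ℝ E : E ≃L[ℝ] E) : E →L[ℝ] E) Set.univ (t.toNNReal * K) := by
      rw [ApproximatesLinearOn.approximatesLinearOn_iff_lipschitzOnWith, lipschitzOnWith_univ]
      refine LipschitzWith.of_dist_le_mul fun x y => ?_
      have h := hK.dist_le_mul x y
      simp only [hH, dist_eq_norm] at h ⊢
      have he : (H - ⇑((ContinuousLinearEquiv.refl ℝ E : E ≃L[ℝ] E) : E →L[ℝ] E)) x -
          (H - ⇑((ContinuousLinearEquiv.refl ℝ E : E ≃L[ℝ] E) : E →L[ℝ] E)) y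
          = t • (g x - g y) := by
        simp [hH, smul_sub]
      rw [he, norm_smul, Real.norm_of_nonneg ht.le]
      push_cast
      rw [Real.coe_toNNReal _ ht.le, mul_assoc]
      gcongr
    have hc : Subsingleton E ∨ t.toNNReal * K <
        ‖((ContinuousLinearEquiv.refl ℝ E).symm : E →L[ℝ] E)‖₊⁻¹ := by
      rcases subsingleton_or_nontrivial E with h | h
      · exact Or.inl h
      · right
        have hone : ‖((ContinuousLinearEquiv.refl ℝ E).symm : E →L[ℝ] E)‖₊ = 1 := by
          rw [← NNReal.coe_inj]
          exact ContinuousLinearMap.norm_id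
        rw [hone, inv_one, ← NNReal.coe_lt_coe]
        push_cast
        rw [Real.coe_toNNReal _ ht.le]
        nlinarith
    exact (hap.toHomeomorph H hc).bijective
  -- `H` is the identity off the ball, hence maps the ball onto itself
  have himage : H '' closedBall (0 : E) R = closedBall 0 R := by
    have hoff : Set.EqOn H id (closedBall (0 : E) R)ᶜ := fun x hx => by
      have : g x = 0 := by
        by_contra h
        exact hx (hR h)
      simp [hH, this]
    rw [← compl_inj_iff, ← Set.image_compl_eq hbij, hoff.image_eq, Set.image_id]
  have hcv := integral_image_eq_integral_abs_det_fderiv_smul volume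
    (isClosed_closedBall (x := (0 : E)) (ε := R)).measurableSet
    (fun x _ => (hderiv x).hasFDerivWithinAt) hbij.1.injOn φ
  rw [himage] at hcv
  rw [hcv]
  refine integral_congr_ae (Eventually.of_forall fun x => ?_)
  simp only [abs_of_pos (hpos x), smul_eq_mul, hH]
  ring

/-- The change of variables formula of degree one for the map `x ↦ x + g x`, where `g` is `C¹`
with support in the ball, and the test functions `(R² - ‖y‖²) ^ k`: along the homotopy
`x ↦ x + t • g x` the integral is a polynomial in `t`, and constant for small `t`. -/
theorem integral_pow_mul_det_eq {g : E → E} {R : ℝ} (hg : ContDiff ℝ 1 g)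
    (hR : Function.support g ⊆ closedBall 0 R) (k : ℕ) :
    ∫ x in closedBall (0 : E) R, (R ^ 2 - ‖x + g x‖ ^ 2) ^ k *
        (ContinuousLinearMap.id ℝ E + fderiv ℝ g x).det =
      ∫ x in closedBall (0 : E) R, (R ^ 2 - ‖x‖ ^ 2) ^ k := by
  obtain ⟨ε, hε, h⟩ := exists_integral_comp_mul_det_eq hg hR
  have key := integral_eq_of_natDegree_le (μ := volume.restrict (closedBall (0 : E) R))
    (F := fun t x => (R ^ 2 - ‖x + t • g x‖ ^ 2) ^ k *
        (ContinuousLinearMap.id ℝ E + t • fderiv ℝ g x).det)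
    (d := k * 2 + Module.finrank ℝ E) ?_ ?_ hε
    (fun t ht htε => h t ht htε fun y => (R ^ 2 - ‖y‖ ^ 2) ^ k) 1
  · simpa using key
  · intro t
    refine ContinuousOn.integrableOn_compact (isCompact_closedBall 0 R) ?_
    have h1 := hg.continuous
    have h2 : Continuous fun x => (ContinuousLinearMap.id ℝ E + t • fderiv ℝ g x).det :=
      ContinuousLinearMap.continuous_det.comp
        (continuous_const.add ((hg.continuous_fderiv one_ne_zero).const_smul t))
    exact Continuous.continuousOn (by fun_prop)
  · intro x
    obtain ⟨p, hpd, hp⟩ := exists_polynomial_det_one_add_smul (fderiv ℝ g x)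
    refine ⟨(C (R ^ 2 - ‖x‖ ^ 2) - C (2 * ⟪x, g x⟫_ℝ) * X - C (‖g x‖ ^ 2) * X ^ 2) ^ k * p,
      natDegree_mul_le.trans (add_le_add ?_ hpd), fun t => ?_⟩
    · refine natDegree_pow_le.trans (Nat.mul_le_mul_left k ?_)
      compute_degree
    · rw [eval_mul, hp, norm_add_sq_real, inner_smul_right, norm_smul, mul_pow, Real.norm_eq_abs,
        sq_abs]
      simp only [eval_pow, eval_sub, eval_mul, eval_C, eval_X]
      ring

/-- A compactly supported `C¹` perturbation of the identity has a zero. Otherwise its norm is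
bounded below by some `δ > 0`, and the two sides of `integral_pow_mul_det_eq` grow at most like
`(R² - δ²) ^ k` and at least like `(R² - δ² / 4) ^ k`. -/
theorem exists_add_eq_zero_of_contDiff {g : E → E} (hg : ContDiff ℝ 1 g)
    (hcs : HasCompactSupport g) : ∃ x, x + g x = 0 := by
  by_contra! hne
  obtain ⟨M, hM⟩ := hcs.exists_bound_of_continuous hg.continuous
  have hM0 : 0 ≤ M := (norm_nonneg _).trans (hM 0)
  obtain ⟨R₀, hR₀⟩ := hcs.isCompact.isBounded.subset_closedBall (0 : E)
  set R : ℝ := max R₀ 0 + M with hRdef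
  have hR0 : 0 ≤ R := by positivity
  have hR₀R : max R₀ 0 ≤ R := by linarith
  have hsupp : Function.support g ⊆ closedBall 0 R :=
    (subset_tsupport g).trans (hR₀.trans (closedBall_subset_closedBall
      ((le_max_left _ _).trans hR₀R)))
  have hle : ∀ x ∈ closedBall (0 : E) R, ‖x + g x‖ ≤ R := by
    intro x hx
    by_cases h : g x = 0
    · simpa [h] using hx
    · have hx' : ‖x‖ ≤ R₀ := by simpa using hR₀ (subset_tsupport g h)
      calc ‖x + g x‖ ≤ ‖x‖ + ‖g x‖ := norm_add_le _ _
        _ ≤ R := add_le_add (hx'.trans (le_max_left _ _)) (hM x)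
  have hcont : Continuous fun x => x + g x := continuous_id.add hg.continuous
  obtain ⟨x₀, hx₀, hmin⟩ := (isCompact_closedBall (0 : E) R).exists_isMinOn
    ⟨0, mem_closedBall_self hR0⟩ hcont.norm.continuousOn
  set δ : ℝ := ‖x₀ + g x₀‖
  have hδ : 0 < δ := norm_pos_iff.2 (hne x₀)
  have hδR : δ ≤ R := hle x₀ hx₀
  have hJ : Continuous fun x => (ContinuousLinearMap.id ℝ E + fderiv ℝ g x).det :=
    ContinuousLinearMap.continuous_det.comp
      (continuous_const.add (hg.continuous_fderiv one_ne_zero))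
  obtain ⟨D, hD⟩ := (isCompact_closedBall (0 : E) R).exists_bound_of_continuousOn hJ.continuousOn
  set a : ℝ := R ^ 2 - δ ^ 2
  set b : ℝ := R ^ 2 - δ ^ 2 / 4
  have ha : 0 ≤ a := by simp only [a]; nlinarith
  have hab : a < b := by simp only [a, b]; nlinarith [sq_pos_of_pos hδ]
  have hb : 0 < b := ha.trans_lt hab
  set V : ℝ := volume.real (closedBall (0 : E) R)
  set v : ℝ := volume.real (closedBall (0 : E) (δ / 2))
  have hv : 0 < v := by
    refine ENNReal.toReal_pos (measure_closedBall_pos _ _ (by positivity)).ne' ?_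
    exact measure_closedBall_lt_top.ne
  have hupper : ∀ k : ℕ, ∫ x in closedBall (0 : E) R, (R ^ 2 - ‖x‖ ^ 2) ^ k ≤ a ^ k * (D * V) := by
    intro k
    rw [← integral_pow_mul_det_eq hg hsupp k]
    refine (le_abs_self _).trans ?_
    rw [← Real.norm_eq_abs, ← mul_assoc]
    refine norm_setIntegral_le_of_norm_le_const measure_closedBall_lt_top fun x hx => ?_
    rw [norm_mul, norm_pow]
    refine mul_le_mul (pow_le_pow_left₀ (norm_nonneg _) ?_ k) (hD x hx) (norm_nonneg _)
      (pow_nonneg ha k)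
    have h1 : δ ≤ ‖x + g x‖ := hmin hx
    have h2 := hle x hx
    rw [Real.norm_of_nonneg (by nlinarith [norm_nonneg (x + g x)])]
    simp only [a]
    nlinarith
  have hlower : ∀ k : ℕ, b ^ k * v ≤ ∫ x in closedBall (0 : E) R, (R ^ 2 - ‖x‖ ^ 2) ^ k := by
    intro k
    have hpc : Continuous fun x : E => (R ^ 2 - ‖x‖ ^ 2) ^ k := by fun_prop
    have hi : ∀ r, IntegrableOn (fun x : E => (R ^ 2 - ‖x‖ ^ 2) ^ k) (closedBall 0 r) := fun r =>
      hpc.continuousOn.integrableOn_compact (isCompact_closedBall 0 r)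
    have hnn : ∀ x ∈ closedBall (0 : E) R, 0 ≤ (R ^ 2 - ‖x‖ ^ 2) ^ k := by
      intro x hx
      have : ‖x‖ ≤ R := by simpa using hx
      exact pow_nonneg (by nlinarith [norm_nonneg x]) k
    calc b ^ k * v = ∫ x in closedBall (0 : E) (δ / 2), b ^ k := by
          rw [setIntegral_const, smul_eq_mul, mul_comm]
      _ ≤ ∫ x in closedBall (0 : E) (δ / 2), (R ^ 2 - ‖x‖ ^ 2) ^ k := by
          refine setIntegral_mono_on (integrableOn_const measure_closedBall_lt_top.ne) (hi _)
            isClosed_closedBall.measurableSet fun x hx => pow_le_pow_left₀ hb.le ?_ k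
          have : ‖x‖ ≤ δ / 2 := by simpa using hx
          simp only [b]
          nlinarith [norm_nonneg x]
      _ ≤ ∫ x in closedBall (0 : E) R, (R ^ 2 - ‖x‖ ^ 2) ^ k := by
          refine setIntegral_mono_set (hi R) ?_ ?_
          · exact (ae_restrict_iff' isClosed_closedBall.measurableSet).2 (Eventually.of_forall hnn)
          · exact (closedBall_subset_closedBall (by linarith)).eventuallyLE
  have hlim : Tendsto (fun k : ℕ => (a / b) ^ k * (D * V)) atTop (𝓝 (0 * (D * V))) :=
    (tendsto_pow_atTop_nhds_zero_of_lt_one (by positivity) ((div_lt_one hb).2 hab)).mul_const _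
  rw [zero_mul] at hlim
  refine hv.not_ge (ge_of_tendsto hlim (Eventually.of_forall fun k => ?_))
  rw [div_pow, div_mul_eq_mul_div, le_div_iff₀ (pow_pos hb k), mul_comm]
  exact (hlower k).trans (hupper k)

end Degree

/-- **Brouwer's fixed point theorem**, for a continuous self-map of the whole space with bounded
range. -/
theorem exists_isFixedPt_of_continuous_of_bounded {f : E → E} (hf : Continuous f) {C : ℝ}
    (hC : ∀ x, ‖f x‖ ≤ C) : ∃ x, f x = x := by
  borelize E
  by_contra! hne
  have hC0 : 0 ≤ C := (norm_nonneg _).trans (hC 0)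
  -- a cutoff of `f` that agrees with `f` on the ball of radius `C`
  set χ : E → ℝ := fun x => max 0 (min 1 (C + 1 - ‖x‖)) with hχ
  have hχ0 : ∀ x, 0 ≤ χ x := fun x => le_max_left _ _
  have hχ1 : ∀ x, χ x ≤ 1 := fun x => max_le zero_le_one (min_le_left _ _)
  set G : E → E := fun x => -(χ x • f x) with hG
  have hGc : Continuous G := by
    have : Continuous χ := by fun_prop
    fun_prop
  have hGs : Function.support G ⊆ closedBall 0 (C + 1) := by
    intro x hx
    by_contra h
    refine hx ?_
    have hx' : C + 1 < ‖x‖ := by simpa using h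
    have : χ x = 0 := max_eq_left ((min_le_right _ _).trans (by linarith))
    simp [hG, this]
  have hzero : ∀ x, x + G x ≠ 0 := by
    intro x hx
    have hx' : x = χ x • f x := by simpa [hG, add_neg_eq_zero] using hx
    have hxC : ‖x‖ ≤ C := by
      rw [hx', norm_smul, Real.norm_of_nonneg (hχ0 x)]
      nlinarith [hC x, hχ0 x, hχ1 x, norm_nonneg (f x)]
    have h1 : χ x = 1 := by
      simp only [hχ]
      rw [min_eq_left (by linarith), max_eq_right zero_le_one]
    rw [h1, one_smul] at hx'
    exact hne x hx'.symm
  obtain ⟨g, hg, hgG, hgs⟩ := hGc.exists_contDiff_approx 1 (ε := fun x => ‖x + G x‖)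
    (by fun_prop) fun x => norm_pos_iff.2 (hzero x)
  obtain ⟨x, hx⟩ := exists_add_eq_zero_of_contDiff (by exact_mod_cast hg)
    (HasCompactSupport.of_support_subset_isCompact (isCompact_closedBall 0 (C + 1))
      (hgs.trans hGs))
  refine (hgG x).ne ?_
  rw [dist_eq_norm, eq_neg_of_add_eq_zero_right hx, ← norm_neg]
  congr 1
  abel

/-- Brouwer's fixed point theorem for the cube, for a map defined on the whole space. -/
theorem exists_isFixedPt_of_mem_Icc {ι : Type*} [Fintype ι] {f : (ι → ℝ) → ι → ℝ}
    (hf : Continuous f) (h01 : ∀ x i, f x i ∈ Set.Icc (0 : ℝ) 1) : ∃ x, f x = x := by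
  let e := EuclideanSpace.equiv ι ℝ
  have hc : Continuous fun x => e.symm (f (e x)) := by fun_prop
  obtain ⟨C, hC⟩ := ((isCompact_univ_pi fun _ : ι => isCompact_Icc (a := (0 : ℝ)) (b := 1)).image
    e.symm.continuous).isBounded.exists_norm_le
  obtain ⟨x, hx⟩ := exists_isFixedPt_of_continuous_of_bounded hc (C := C) fun x =>
    hC _ ⟨_, fun i _ => h01 _ i, rfl⟩
  exact ⟨e x, e.symm_apply_eq.1 hx⟩

end Brouwer

namespace FirstPriceAuction

/-! ### Winning probabilities -/

/-- The share of the item that bidder `i` gets at the bid profile `b`. -/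
noncomputable def winShare {n : ℕ} (b : Fin n → ℝ) (i : Fin n) : ℝ :=
  if i ∈ winners b then 1 / ((winners b).card : ℝ) else 0

theorem exPostUtility_eq {n : ℕ} (b : Fin n → ℝ) (i : Fin n) (v : ℝ) :
    exPostUtility b i v = winShare b i * (v - b i) := by
  unfold exPostUtility winShare
  split_ifs <;> simp

theorem winShare_nonneg {n : ℕ} (b : Fin n → ℝ) (i : Fin n) : 0 ≤ winShare b i := by
  unfold winShare
  split_ifs <;> positivity

theorem winShare_le_one {n : ℕ} (b : Fin n → ℝ) (i : Fin n) : winShare b i ≤ 1 := by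
  unfold winShare
  split_ifs with h
  · have : 1 ≤ (winners b).card := Finset.card_pos.2 ⟨i, h⟩
    exact div_le_one_of_le₀ (by exact_mod_cast this) (by positivity)
  · exact zero_le_one

/-- Raising one's own bid does not lower one's share. -/
theorem winShare_mono {n : ℕ} {b c : Fin n → ℝ} {i : Fin n} (hi : b i ≤ c i)
    (hne : ∀ j ≠ i, c j = b j) : winShare b i ≤ winShare c i := by
  rcases hi.eq_or_lt with h | h
  · have : c = b := funext fun j => by
      by_cases hj : j = i
      · rw [hj, h]
      · exact hne j hj
    rw [this]
  · by_cases hw : i ∈ winners b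
    · have hb : ∀ j, b j ≤ b i := (Finset.mem_filter.1 hw).2
      have hc : winners c = {i} := by
        ext j
        simp only [winners, Finset.mem_filter, Finset.mem_univ, true_and, Finset.mem_singleton]
        constructor
        · intro hj
          by_contra hji
          have h1 := hj i
          rw [hne j hji] at h1
          exact absurd (h1.trans (hb j)) h.not_ge
        · rintro rfl k
          by_cases hk : k = j
          · rw [hk]
          · rw [hne k hk]
            exact (hb k).trans hi
      refine (winShare_le_one b i).trans ?_
      simp [winShare, hc]
    · rw [winShare, if_neg hw]
      exact winShare_nonneg c i

variable {n : ℕ} (A : FirstPriceAuction n)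

/-- The probability, in the eyes of bidder `i`, of getting the item with the bid `b` against the
strategies of the others in `β`. -/
noncomputable def winProb (β : Fin n → A.Strategy) (i : Fin n) (b : A.bids) : ℝ :=
  ∫ w, winShare (A.bidProfile β i b w) i
    ∂Measure.pi fun j : {j : Fin n // j ≠ i} => (A.prior i j : Measure I)

theorem bidProfile_self (β : Fin n → A.Strategy) (i : Fin n) (b : A.bids)
    (w : {j : Fin n // j ≠ i} → I) : A.bidProfile β i b w i = b :=
  dif_pos rfl

theorem utility_eq (β : Fin n → A.Strategy) (i : Fin n) (b : A.bids) (v : I) :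
    A.utility β i b v = A.winProb β i b * ((v : ℝ) - b) := by
  simp only [utility, winProb, exPostUtility_eq, bidProfile_self]
  exact integral_mul_const _ _

theorem winProb_nonneg (β : Fin n → A.Strategy) (i : Fin n) (b : A.bids) : 0 ≤ A.winProb β i b :=
  integral_nonneg fun _ => winShare_nonneg _ _

variable {A}

/-- A function of the values that depends on them only through the bids is measurable, the bids
being finite in number. -/
theorem measurable_comp_bids {β : Fin n → A.Strategy} (hβ : ∀ j, Measurable (β j)) (i : Fin n)
    (f : ({j : Fin n // j ≠ i} → A.bids) → ℝ) :
    Measurable fun w : {j : Fin n // j ≠ i} → I => f fun j => β j (w j) := by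
  have hf : Measurable f := Measurable.of_discrete
  have h : Measurable fun (w : {j : Fin n // j ≠ i} → I) (j : {j : Fin n // j ≠ i}) =>
      β j (w j) := measurable_pi_lambda _ fun j => (hβ j).comp (measurable_pi_apply j)
  exact Measurable.comp hf h

theorem measurable_winShare {β : Fin n → A.Strategy} (hβ : ∀ j, Measurable (β j)) (i : Fin n)
    (b : A.bids) : Measurable fun w => winShare (A.bidProfile β i b w) i :=
  measurable_comp_bids hβ i fun c =>
    winShare (fun j => if h : j = i then (b : ℝ) else (c ⟨j, h⟩ : ℝ)) i

theorem integrable_winShare {β : Fin n → A.Strategy} (hβ : ∀ j, Measurable (β j)) (i : Fin n)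
    (b : A.bids) : Integrable (fun w => winShare (A.bidProfile β i b w) i)
      (Measure.pi fun j : {j : Fin n // j ≠ i} => (A.prior i j : Measure I)) :=
  Integrable.of_bound (measurable_winShare hβ i b).aestronglyMeasurable 1
    (Filter.Eventually.of_forall fun w => by
      rw [Real.norm_of_nonneg (winShare_nonneg _ _)]
      exact winShare_le_one _ _)

theorem winProb_mono {β : Fin n → A.Strategy} (hβ : ∀ j, Measurable (β j)) (i : Fin n) :
    Monotone (A.winProb β i) := fun b c hbc => by
  refine integral_mono (integrable_winShare hβ i b) (integrable_winShare hβ i c) fun w =>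
    winShare_mono ?_ fun j hj => ?_
  · simpa [bidProfile_self] using hbc
  · simp [bidProfile, hj]

/-- A prior may have an atom at the value `0`, but nowhere else. -/
theorem prior_singleton (i : Fin n) (j : {j : Fin n // j ≠ i}) {x : I} (hx : x ≠ 0) :
    (A.prior i j : Measure I) {x} = 0 := by
  rw [← measureReal_eq_zero_iff]
  refine le_antisymm ?_ measureReal_nonneg
  have hlim := ((A.continuous_prior i j).tendsto x).const_sub
    ((A.prior i j : Measure I).real (Set.Iic x))
  rw [sub_self] at hlim
  have hbot : (nhdsWithin x (Set.Iio x)).NeBot :=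
    nhdsLT_neBot_of_exists_lt ⟨0, bot_lt_iff_ne_bot.2 hx⟩
  refine ge_of_tendsto (hlim.mono_left (nhdsWithin_le_nhds (s := Set.Iio x))) ?_
  filter_upwards [self_mem_nhdsWithin] with y hy
  rw [← measureReal_sdiff (Set.Iic_subset_Iic.2 (le_of_lt hy)) measurableSet_Iic]
  refine measureReal_mono (Set.singleton_subset_iff.2 ⟨Set.mem_Iic.2 le_rfl, ?_⟩)
  simpa using hy

/-! ### Threshold strategies -/

variable (A)

/-- The null bid. -/
def nullBid : A.bids := ⟨0, A.zero_mem⟩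

variable {A}

theorem bid_nonneg (b : A.bids) : (0 : ℝ) ≤ b := (A.bids_subset b b.2).1

theorem nullBid_le (b : A.bids) : A.nullBid ≤ b := bid_nonneg b

/-- The value above which bidder `i` considers the bid `b`. The parameter `t` is an arbitrary family
of reals; the threshold is raised to `b` in order to exclude overbidding. -/
def threshold (t : Fin n × A.bids → ℝ) (i : Fin n) (b : A.bids) : ℝ := max (t (i, b)) b

/-- The bids that bidder `i` considers at the value `v`: the null bid, and those with threshold
less than `v`. -/
noncomputable def activeBids (t : Fin n × A.bids → ℝ) (i : Fin n) (v : I) : Finset A.bids :=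
  Finset.univ.filter fun b => b = A.nullBid ∨ threshold t i b < v

theorem mem_activeBids {t : Fin n × A.bids → ℝ} {i : Fin n} {v : I} {b : A.bids} :
    b ∈ activeBids t i v ↔ b = A.nullBid ∨ threshold t i b < v := by
  simp [activeBids]

theorem activeBids_nonempty (t : Fin n × A.bids → ℝ) (i : Fin n) (v : I) :
    (activeBids t i v).Nonempty :=
  ⟨A.nullBid, mem_activeBids.2 (Or.inl rfl)⟩

/-- The strategy of bidding as high as the thresholds permit. The thresholds need not be ordered;
that a bid is not used at its threshold itself makes the bid at the value `0` independent of `t`. -/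
noncomputable def thresholdStrategy (t : Fin n × A.bids → ℝ) (i : Fin n) : A.Strategy :=
  fun v => (activeBids t i v).max' (activeBids_nonempty t i v)

theorem thresholdStrategy_monotone (t : Fin n × A.bids → ℝ) (i : Fin n) :
    Monotone (thresholdStrategy t i) := fun _ _ hvw =>
  Finset.max'_subset _ fun _ hb =>
    mem_activeBids.2 ((mem_activeBids.1 hb).imp_right fun h => h.trans_le hvw)

theorem thresholdStrategy_measurable (t : Fin n × A.bids → ℝ) (i : Fin n) :
    Measurable (thresholdStrategy t i) := by
  have h : Monotone fun v => (thresholdStrategy t i v : ℝ) := thresholdStrategy_monotone t i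
  exact h.measurable.subtype_mk

theorem thresholdStrategy_mem (t : Fin n × A.bids → ℝ) (i : Fin n) (v : I) :
    thresholdStrategy t i v = A.nullBid ∨ threshold t i (thresholdStrategy t i v) < v :=
  mem_activeBids.1 (Finset.max'_mem _ (activeBids_nonempty t i v))

theorem le_threshold_of_thresholdStrategy_lt {t : Fin n × A.bids → ℝ} {i : Fin n} {v : I}
    {b : A.bids} (h : thresholdStrategy t i v < b) : (v : ℝ) ≤ threshold t i b := by
  by_contra! hb
  exact h.not_ge (Finset.le_max' _ _ (mem_activeBids.2 (Or.inr hb)))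

theorem thresholdStrategy_le (t : Fin n × A.bids → ℝ) (i : Fin n) (v : I) :
    (thresholdStrategy t i v : ℝ) ≤ v := by
  rcases thresholdStrategy_mem t i v with h | h
  · rw [h]
    exact v.2.1
  · exact (le_max_right _ _).trans h.le

theorem continuous_threshold (i : Fin n) (b : A.bids) :
    Continuous fun t : Fin n × A.bids → ℝ => threshold t i b := by
  unfold threshold
  fun_prop

/-- Away from the thresholds, and at the value `0`, the bid is locally constant in the thresholds. -/
theorem eventually_thresholdStrategy_eq {t : Fin n × A.bids → ℝ} {i : Fin n} {v : I}
    (h : v = 0 ∨ ∀ b, (v : ℝ) ≠ threshold t i b) :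
    ∀ᶠ s in nhds t, thresholdStrategy s i v = thresholdStrategy t i v := by
  have hb : ∀ b : A.bids, ∀ᶠ s in nhds t, threshold s i b < v ↔ threshold t i b < v := by
    intro b
    rcases h with rfl | h
    · refine Filter.Eventually.of_forall fun s => ?_
      have h0 : ∀ s : Fin n × A.bids → ℝ, 0 ≤ threshold s i b := fun s =>
        (bid_nonneg b).trans (le_max_right _ _)
      simp [(h0 s).not_gt, (h0 t).not_gt]
    · have hc := (continuous_threshold (A := A) i b).tendsto t
      rcases (h b).lt_or_gt with hlt | hgt
      · filter_upwards [hc.eventually_const_lt hlt] with s hs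
        simp [hs.not_gt, hlt.not_gt]
      · filter_upwards [hc.eventually_lt_const hgt] with s hs
        simp [hs, hgt]
  filter_upwards [Filter.eventually_all.2 hb] with s hs
  have : activeBids s i v = activeBids t i v := by
    ext b
    rw [mem_activeBids, mem_activeBids, hs b]
  simp only [thresholdStrategy, this]

/-- Winning probabilities depend continuously on the thresholds, because the priors have no atoms
in `(0, 1]`. -/
theorem continuous_winProb (i : Fin n) (b : A.bids) :
    Continuous fun t : Fin n × A.bids → ℝ => A.winProb (thresholdStrategy t) i b := by
  refine continuous_iff_continuousAt.2 fun t => ?_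
  refine continuousAt_of_dominated (bound := fun _ => 1)
    (Filter.Eventually.of_forall fun s =>
      (measurable_winShare (thresholdStrategy_measurable s) i b).aestronglyMeasurable)
    (Filter.Eventually.of_forall fun s => Filter.Eventually.of_forall fun w => ?_)
    (integrable_const _) ?_
  · rw [Real.norm_of_nonneg (winShare_nonneg _ _)]
    exact winShare_le_one _ _
  · have hgood : ∀ j : {j : Fin n // j ≠ i}, ∀ᵐ v : I ∂(A.prior i j : Measure I),
        v = 0 ∨ ∀ c, (v : ℝ) ≠ threshold t j c := by
      intro j
      have hc : ∀ c : A.bids, ∀ᵐ v : I ∂(A.prior i j : Measure I),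
          v = 0 ∨ (v : ℝ) ≠ threshold t j c := by
        intro c
        rw [ae_iff]
        by_cases hx : ∃ x : I, x ≠ 0 ∧ (x : ℝ) = threshold t j c
        · obtain ⟨x, hx0, hx⟩ := hx
          refine measure_mono_null (fun v hv => ?_) (prior_singleton i j hx0)
          simp only [not_or, not_not, Set.mem_ofPred_eq] at hv
          exact Subtype.ext (hv.2.trans hx.symm)
        · convert measure_empty (μ := (A.prior i j : Measure I))
          refine Set.eq_empty_of_forall_notMem fun v hv => hx ?_
          simp only [not_or, not_not, Set.mem_ofPred_eq] at hv
          exact ⟨v, hv⟩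
      filter_upwards [ae_all_iff.2 hc] with v hv
      by_cases h0 : v = 0
      · exact Or.inl h0
      · exact Or.inr fun c => (hv c).resolve_left h0
    have hall : ∀ᵐ w ∂Measure.pi fun j : {j : Fin n // j ≠ i} => (A.prior i j : Measure I),
        ∀ j : {j : Fin n // j ≠ i}, w j = 0 ∨ ∀ c, (w j : ℝ) ≠ threshold t j c :=
      ae_all_iff.2 fun j => (Measure.tendsto_eval_ae_ae
        (μ := fun j : {j : Fin n // j ≠ i} => (A.prior i j : Measure I))).eventually (hgood j)
    filter_upwards [hall] with w hw
    refine continuousAt_const.congr (f := fun _ =>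
      winShare (A.bidProfile (thresholdStrategy t) i b w) i) ?_
    filter_upwards [Filter.eventually_all.2 fun j => eventually_thresholdStrategy_eq (hw j)]
      with s hs
    congr 1
    funext j
    unfold bidProfile
    split_ifs with h
    · rfl
    · rw [hs ⟨j, h⟩]

/-! ### Equilibrium thresholds -/

/-- The payoff at the value `x` of bidder `i` from the bid `b` against threshold strategies. -/
noncomputable def payoff (t : Fin n × A.bids → ℝ) (i : Fin n) (b : A.bids) (x : ℝ) : ℝ :=
  A.winProb (thresholdStrategy t) i b * (x - b)

/-- The bids at least `b`. -/
noncomputable def upperBids (b : A.bids) : Finset A.bids := Finset.univ.filter fun c => b ≤ c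

/-- The bids less than `b`, and the null bid. -/
noncomputable def lowerBids (b : A.bids) : Finset A.bids :=
  Finset.univ.filter fun c => c < b ∨ c = A.nullBid

theorem upperBids_nonempty (b : A.bids) : (upperBids b).Nonempty := ⟨b, by simp [upperBids]⟩

theorem lowerBids_nonempty (b : A.bids) : (lowerBids b).Nonempty :=
  ⟨A.nullBid, by simp [lowerBids]⟩

/-- What bidder `i` gains by bidding at least `b` instead of less than `b`, at the threshold
of `b`. -/
noncomputable def thresholdGain (t : Fin n × A.bids → ℝ) (i : Fin n) (b : A.bids) : ℝ :=
  (upperBids b).sup' (upperBids_nonempty b) (fun c => payoff t i c (threshold t i b)) -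
    (lowerBids b).sup' (lowerBids_nonempty b) (fun c => payoff t i c (threshold t i b))

theorem continuous_thresholdGain (i : Fin n) (b : A.bids) :
    Continuous fun t : Fin n × A.bids → ℝ => thresholdGain t i b := by
  have h : ∀ c : A.bids, Continuous fun t : Fin n × A.bids → ℝ =>
      payoff t i c (threshold t i b) := fun c =>
    (continuous_winProb i c).mul ((continuous_threshold i b).sub continuous_const)
  exact (Continuous.finset_sup'_apply _ fun c _ => h c).sub
    (Continuous.finset_sup'_apply _ fun c _ => h c)

/-- Some thresholds are such that no bid `b` is better than all lower bids at its threshold, and,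
unless this threshold is at least `1`, no lower bid is better than all bids from `b` on. They are a
fixed point of the map that lowers a threshold by its gain. -/
theorem exists_equilibrium_thresholds (A : FirstPriceAuction n) :
    ∃ t : Fin n × A.bids → ℝ, ∀ i (b : A.bids), b ≠ A.nullBid →
      (∃ c < b, payoff t i b (threshold t i b) ≤ payoff t i c (threshold t i b)) ∧
      (threshold t i b < 1 → ∀ c < b, ∃ d, b ≤ d ∧
        payoff t i c (threshold t i b) ≤ payoff t i d (threshold t i b)) := by
  obtain ⟨t, ht⟩ := exists_isFixedPt_of_mem_Icc
    (f := fun (t : Fin n × A.bids → ℝ) p => max 0 (min 1 (t p - thresholdGain t p.1 p.2)))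
    (continuous_pi fun p => by
      have := continuous_thresholdGain p.1 p.2
      fun_prop)
    fun t p => ⟨le_max_left _ _, max_le zero_le_one (min_le_left _ _)⟩
  refine ⟨t, fun i b hb => ⟨?_, fun h1 c hc => ?_⟩⟩
  · have htb : max 0 (min 1 (t (i, b) - thresholdGain t i b)) = t (i, b) := congrFun ht (i, b)
    have hb0 : A.nullBid < b := lt_of_le_of_ne (nullBid_le b) hb.symm
    have h0 : 0 ≤ t (i, b) := htb ▸ le_max_left _ _
    rcases h0.eq_or_lt with h0 | h0
    · -- a threshold at `0` is raised to `b`, where the bid `b` has payoff `0`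
      refine ⟨A.nullBid, hb0, ?_⟩
      have hth : threshold t i b = b := by
        rw [threshold, ← h0]
        exact max_eq_right (bid_nonneg b)
      rw [payoff, payoff, hth, sub_self, mul_zero]
      exact mul_nonneg (A.winProb_nonneg _ _ _) (sub_nonneg.2 (nullBid_le b))
    · have hgain : thresholdGain t i b ≤ 0 := by
        by_contra! hg
        have : max 0 (min 1 (t (i, b) - thresholdGain t i b)) < t (i, b) :=
          max_lt h0 ((min_le_right _ _).trans_lt (by linarith))
        exact this.ne htb
      obtain ⟨c, hc, hce⟩ := Finset.exists_mem_eq_sup' (lowerBids_nonempty b)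
        fun c => payoff t i c (threshold t i b)
      refine ⟨c, ?_, ?_⟩
      · rcases (Finset.mem_filter.1 hc).2 with h | h
        · exact h
        · exact h ▸ hb0
      · rw [← hce]
        exact (Finset.le_sup' (fun c => payoff t i c (threshold t i b))
          (by simp [upperBids])).trans (sub_nonpos.1 hgain)
  · have htb : max 0 (min 1 (t (i, b) - thresholdGain t i b)) = t (i, b) := congrFun ht (i, b)
    have ht1 : t (i, b) < 1 := (le_max_left _ _).trans_lt h1
    have hgain : 0 ≤ thresholdGain t i b := by
      by_contra! hg
      have : t (i, b) < max 0 (min 1 (t (i, b) - thresholdGain t i b)) :=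
        (lt_min ht1 (by linarith)).trans_le (le_max_right _ _)
      exact this.ne' htb
    obtain ⟨d, hd, hde⟩ := Finset.exists_mem_eq_sup' (upperBids_nonempty b)
      fun c => payoff t i c (threshold t i b)
    refine ⟨d, (Finset.mem_filter.1 hd).2, ?_⟩
    rw [← hde]
    exact (Finset.le_sup' (fun c => payoff t i c (threshold t i b))
      (by simp [lowerBids, hc])).trans (sub_nonneg.1 hgain)

theorem winProb_thresholdStrategy_mono (t : Fin n × A.bids → ℝ) (i : Fin n) :
    Monotone (A.winProb (thresholdStrategy t) i) :=
  winProb_mono (thresholdStrategy_measurable t) i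

/-- Single crossing: a higher bid gains on a lower one as the value grows. -/
theorem payoff_sub_le_payoff_sub (t : Fin n × A.bids → ℝ) (i : Fin n) {b c : A.bids} (hbc : b ≤ c)
    {x y : ℝ} (hxy : x ≤ y) :
    payoff t i c x - payoff t i b x ≤ payoff t i c y - payoff t i b y := by
  have := winProb_thresholdStrategy_mono t i hbc
  unfold payoff
  nlinarith

/-- At the thresholds of `exists_equilibrium_thresholds` the bids of the threshold strategy are
optimal at every value. -/
theorem payoff_le_payoff_thresholdStrategy {t : Fin n × A.bids → ℝ} {i : Fin n}
    (h₁ : ∀ b : A.bids, b ≠ A.nullBid →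
      ∃ c < b, payoff t i b (threshold t i b) ≤ payoff t i c (threshold t i b))
    (h₂ : ∀ b : A.bids, b ≠ A.nullBid → threshold t i b < 1 → ∀ c < b, ∃ d, b ≤ d ∧
      payoff t i c (threshold t i b) ≤ payoff t i d (threshold t i b)) (v : I) (b : A.bids) :
    payoff t i b v ≤ payoff t i (thresholdStrategy t i v) v := by
  classical
  set β := thresholdStrategy t i v with hβ
  -- the least optimal bid `m`
  obtain ⟨m, hm, hmin⟩ : ∃ m : A.bids, (∀ c, payoff t i c v ≤ payoff t i m v) ∧
      ∀ c, c < m → payoff t i c v < payoff t i m v := by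
    obtain ⟨m₀, -, hm₀⟩ := Finset.exists_max_image Finset.univ (fun c : A.bids => payoff t i c v)
      ⟨A.nullBid, Finset.mem_univ _⟩
    have hne : (Finset.univ.filter fun m : A.bids =>
        ∀ c, payoff t i c v ≤ payoff t i m v).Nonempty :=
      ⟨m₀, by simpa using fun c hc => hm₀ ⟨c, hc⟩ (Finset.mem_univ _)⟩
    have hmem := (Finset.mem_filter.1 (Finset.min'_mem _ hne)).2
    refine ⟨_, hmem, fun c hc => lt_of_not_ge fun hle => ?_⟩
    exact hc.not_ge (Finset.min'_le _ _ (Finset.mem_filter.2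
      ⟨Finset.mem_univ _, fun d => (hmem d).trans hle⟩))
  have hmβ : m ≤ β := by
    by_contra! hlt
    have hm0 : m ≠ A.nullBid := fun h => hlt.not_ge (h ▸ nullBid_le β)
    obtain ⟨c, hcm, hc⟩ := h₁ m hm0
    have := payoff_sub_le_payoff_sub t i hcm.le (le_threshold_of_thresholdStrategy_lt hlt)
    linarith [hmin c hcm]
  refine (hm b).trans ?_
  rcases hmβ.eq_or_lt with h | hlt
  · rw [h]
  have hβ0 : β ≠ A.nullBid := fun h => hlt.not_ge (h ▸ nullBid_le m)
  have hτ : threshold t i β < v := (thresholdStrategy_mem t i v).resolve_left hβ0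
  obtain ⟨l, hβl, hl⟩ := h₂ β hβ0 (hτ.trans_le v.2.2) m hlt
  -- `m` and `l` are equally good at the threshold of `β` and at `v`, hence win equally often;
  -- as the bid `l` is higher, neither they nor the bid `β` in between ever win
  have hml : m < l := hlt.trans_le hβl
  have hQ := winProb_thresholdStrategy_mono t i
  have hQml := hQ hml.le
  have hlv := hm l
  have hmlR : (m : ℝ) < l := hml
  have hQm0 := A.winProb_nonneg (thresholdStrategy t) i m
  simp only [payoff] at hl hlv
  have hQeq : A.winProb (thresholdStrategy t) i l = A.winProb (thresholdStrategy t) i m := by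
    refine le_antisymm ?_ hQml
    by_contra! hlt'
    nlinarith [mul_pos (sub_pos.2 hlt') (sub_pos.2 hτ)]
  have hQ0 : A.winProb (thresholdStrategy t) i m = 0 := by
    rw [hQeq] at hl
    nlinarith
  have hQβ : A.winProb (thresholdStrategy t) i β = 0 :=
    le_antisymm ((hQ hβl).trans (hQeq.trans hQ0).le) (A.winProb_nonneg _ _ _)
  simp [payoff, hQ0, hQβ]

end FirstPriceAuction

theorem mainTheorem3 (n : ℕ) (A : FirstPriceAuction n) :
    ∃ β : Fin n → A.Strategy,
      A.IsBayesNashEquilibrium β ∧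
      (∀ i, Monotone (β i)) ∧
      (∀ (i : Fin n) (v : I), (β i v : ℝ) ≤ (v : ℝ)) := by
  obtain ⟨t, ht⟩ := FirstPriceAuction.exists_equilibrium_thresholds A
  refine ⟨FirstPriceAuction.thresholdStrategy t,
    ⟨FirstPriceAuction.thresholdStrategy_measurable t, fun i v b => ?_⟩,
    FirstPriceAuction.thresholdStrategy_monotone t, FirstPriceAuction.thresholdStrategy_le t⟩
  rw [A.utility_eq, A.utility_eq]
  exact FirstPriceAuction.payoff_le_payoff_thresholdStrategy (fun b hb => (ht i b hb).1)
    (fun b hb => (ht i b hb).2) v b
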